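/- Consider a synchronous clique of $n$ nodes in which every node has a unique ID, knows initially only $n$ and its own ID, holds private random coins that are independent of those of the other nodes, and is connected to the other $n-1$ nodes by bidirectional links through $n-1$ ports whose assignment to the other nodes is arbitrary and unknown to it. Messages may be of any (finite) size. Before the execution an adversary, who does not see the coins, chooses the IDs (from an ID space with at least $n$ elements), the port assignment, and an arbitrary nonempty set of nodes that are awake from the start of round $1$; every other node is asleep, sends nothing while asleep, and wakes up at the end of the first round in which it receives a message. For every constant $\epsilon$ with $0<\epsilon<1$ there are constants $c>0$ and $n_0$, depending only on $\epsilon$, such that the following holds for all $n\ge n_0$. Let $\mathcal A$ be any randomized $2$-round algorithm such that, for every choice of the adversary, with probability at least $1-\epsilon$ all nodes are awake at the end of round $2$ (no other task, such as leader election, is required of $\mathcal A$). Then the expected message complexity of $\mathcal A$ is at least $c\,n^{3/2}$: for some choice of the adversary, the expected total number of messages sent in rounds $1$ and $2$ is at least $c\,n^{3/2}$. -/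

import Mathlib

open MeasureTheory

namespace SyncClique

/-- What a node sends (or receives) in one round: for each of its `n - 1` ports,
either nothing or one message. -/
abbrev PortMessages (n : ℕ) (Msg : Type) : Type := Fin (n - 1) → Option Msg

/-- The port numbering of the clique on `n` nodes: the `n - 1` ports of each node `u` are in
bijection with the `n - 1` other nodes, independently for different nodes. -/
structure PortMapping (n : ℕ) where
  neighbor : (u : Fin n) → Fin (n - 1) ≃ {v : Fin n // v ≠ u}

/-- The map `p((u, i)) = (v, j)`: a message sent by `u` over its port `i` is received by `v`
over its port `j`. -/
def PortMapping.link {n : ℕ} (p : PortMapping n) (x : Fin n × Fin (n - 1)) :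
    Fin n × Fin (n - 1) :=
  ((p.neighbor x.1 x.2 : Fin n),
    (p.neighbor (p.neighbor x.1 x.2 : Fin n)).symm ⟨x.1, (p.neighbor x.1 x.2).2.symm⟩)

/-- Links are bidirectional. -/
theorem PortMapping.link_link {n : ℕ} (p : PortMapping n) (x : Fin n × Fin (n - 1)) :
    p.link (p.link x) = x := by
  have key : ∀ (u v : Fin n) (i : Fin (n - 1)) (y : {w : Fin n // w ≠ v}) (hy : y.1 = u)
      (hu : v ≠ u), p.neighbor u i = ⟨v, hu⟩ →
      ((y : Fin n), (p.neighbor (y : Fin n)).symm ⟨v, y.2.symm⟩) = (u, i) := by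
    rintro u v i ⟨y, hyv⟩ rfl hu h
    simp [← h]
  have hx := (p.neighbor (p.neighbor x.1 x.2 : Fin n)).apply_symm_apply
    ⟨x.1, (p.neighbor x.1 x.2).2.symm⟩
  exact key x.1 (p.neighbor x.1 x.2) x.2 _ (congrArg Subtype.val hx)
    (p.neighbor x.1 x.2).2 rfl

/-- A randomized synchronous algorithm for the clique with `n` nodes (the value of `n` is known
to the nodes).  Each node holds private random coins, drawn from the probability space
`(Coin, law)`.  `send id c root h` is what an awake node sends in the current round, as a function
of everything it knows: its own ID, its coins, whether the adversary woke it up, and the messages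
`h` that arrived at its ports in the previous rounds, listed round by round (so the length of `h`
is the number of previous rounds). -/
structure Algorithm (n : ℕ) (ID Msg : Type) where
  Coin : Type
  [measurableSpaceCoin : MeasurableSpace Coin]
  law : Measure Coin
  [isProbabilityMeasure_law : IsProbabilityMeasure law]
  send : ID → Coin → Bool → List (PortMessages n Msg) → PortMessages n Msg
  measurableSet_send : ∀ id root h out, MeasurableSet {c | send id c root h = out}

attribute [instance] Algorithm.measurableSpaceCoin Algorithm.isProbabilityMeasure_law

/-- The choices of the adversary, made independently of the coins of the nodes: distinct IDs,
the port mapping, and the nonempty set of nodes that are woken up at the start of round 1. -/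
structure Adversary (n : ℕ) (ID : Type) where
  id : Fin n ↪ ID
  ports : PortMapping n
  roots : Finset (Fin n)
  roots_nonempty : roots.Nonempty

variable {n : ℕ} {ID Msg : Type}

/-- A node with arrival history `h` is awake iff it was woken up by the adversary or has
received a message. -/
def Awake (S : Adversary n ID) (u : Fin n) (h : List (PortMessages n Msg)) : Prop :=
  u ∈ S.roots ∨ ∃ arrived ∈ h, ∃ i, arrived i ≠ none

open Classical in
/-- What node `u` with arrival history `h` and coins `c` sends in the next round;
sleeping nodes are silent. -/
noncomputable def outbox (A : Algorithm n ID Msg) (S : Adversary n ID) (u : Fin n) (c : A.Coin)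
    (h : List (PortMessages n Msg)) : PortMessages n Msg :=
  if Awake S u h then A.send (S.id u) c (decide (u ∈ S.roots)) h else fun _ => none

/-- The arrival histories of all nodes after `r` rounds, when node `u` has the coins `ω u`.
In each round, `u` receives over its port `i` what is sent over the other end of that link. -/
noncomputable def history (A : Algorithm n ID Msg) (S : Adversary n ID) (ω : Fin n → A.Coin) :
    ℕ → Fin n → List (PortMessages n Msg)
  | 0, _ => []
  | r + 1, u => history A S ω r u ++
      [fun i => outbox A S (S.ports.link (u, i)).1 (ω (S.ports.link (u, i)).1)
        (history A S ω r (S.ports.link (u, i)).1) (S.ports.link (u, i)).2]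

/-- All nodes are awake at the end of round `r`. -/
def AllAwake (A : Algorithm n ID Msg) (S : Adversary n ID) (r : ℕ) (ω : Fin n → A.Coin) : Prop :=
  ∀ u, Awake S u (history A S ω r u)

open Classical in
/-- The number of messages sent in the first `T` rounds. -/
noncomputable def messageCount (A : Algorithm n ID Msg) (S : Adversary n ID) (T : ℕ)
    (ω : Fin n → A.Coin) : ℕ :=
  ∑ r ∈ Finset.range T, ∑ u : Fin n,
    (Finset.univ.filter fun i => outbox A S u (ω u) (history A S ω r u) i ≠ none).card

/-- The coins of the nodes are independent. -/
noncomputable def coinLaw (A : Algorithm n ID Msg) : Measure (Fin n → A.Coin) :=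
  Measure.pi fun _ => A.law

/-- Whatever the adversary chooses, with probability at least `1 - ε` all nodes are awake at
the end of round `T`. -/
def WakesUpAll (A : Algorithm n ID Msg) (T : ℕ) (ε : ℝ) : Prop :=
  ∀ S : Adversary n ID, 1 - ε ≤ (coinLaw A).real {ω | AllAwake A S T ω}

/-- The expected number of messages sent in the first `T` rounds against adversary `S`. -/
noncomputable def expectedMessages (A : Algorithm n ID Msg) (S : Adversary n ID) (T : ℕ) : ℝ :=
  ∫ ω, (messageCount A S T ω : ℝ) ∂(coinLaw A)

end SyncClique

/-! Fix the IDs and let every node permute its ports uniformly at random, independently of the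
coins. Let `meanFirst` be the expected number of messages a root sends in round 1, and put `d = 1 -
ε`. If the sum of `meanFirst` over all nodes is at least `d/16 * n^(3/2)`, waking everybody up is
already expensive. Otherwise more than half of the nodes have `meanFirst` at most `d/8 * √n`, and
the adversary wakes a set `R` of `⌈√n⌉` of them.

A lone root `u` in `R` sends few messages in round 1, yet about `d * n` messages are needed in
expectation to wake the clique. Hence round 2 must carry that many (`le_sum_meanSecond_singleton`).
When all of `R` is awake, a node that hears only from `u` cannot tell this from the execution with
the single root `u` (`secondCount_eq_singleton`). Random ports make each root of `R` reach a given
node with probability only `O(d/√n)` (`measureReal_sendsTo`), so by a union bound the other roots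
miss it with probability at least `1/2`. This event is independent of what the node would send if
`u` were alone (`integral_secondCount_mul_unheard`).

For each receiver at most one root contributes in this way (`sum_secondCount_singleton_le`), so the
costs of the lone executions add up to order `√n * n` (`le_sum_meanSecond`). Some fixed port mapping
is at least as expensive as the average. -/

namespace SyncClique

/-! ### Two-round executions for fixed coins and ports -/

section Deterministic

variable {n : ℕ} {ID Msg : Type}

open Classical in
/-- The number of messages that a node sends in one round. -/
noncomputable def numSent (out : PortMessages n Msg) : ℕ :=
  (Finset.univ.filter fun i => out i ≠ none).card

theorem numSent_le (out : PortMessages n Msg) : numSent out ≤ n - 1 :=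
  (Finset.card_le_univ _).trans (by simp)

@[simp]
theorem numSent_none : numSent (fun _ => none : PortMessages n Msg) = 0 := by
  simp [numSent]

/-- The number of messages that a root with ID `i` and coins `c` sends in the first round. -/
noncomputable def firstCount (A : Algorithm n ID Msg) (i : ID) (c : A.Coin) : ℕ :=
  numSent (A.send i c true [])

open Classical in
/-- What arrives at `v` in the first round if the set of roots is `R`. -/
noncomputable def arrivals (A : Algorithm n ID Msg) (f : Fin n → ID) (p : PortMapping n)
    (R : Finset (Fin n)) (ω : Fin n → A.Coin) (v : Fin n) : PortMessages n Msg :=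
  fun i => if (p.link (v, i)).1 ∈ R then
    A.send (f (p.link (v, i)).1) (ω (p.link (v, i)).1) true [] (p.link (v, i)).2 else none

open Classical in
/-- What `v` sends in the second round if the set of roots is `R`. -/
noncomputable def secondOut (A : Algorithm n ID Msg) (f : Fin n → ID) (p : PortMapping n)
    (R : Finset (Fin n)) (ω : Fin n → A.Coin) (v : Fin n) : PortMessages n Msg :=
  if v ∈ R ∨ ∃ i, arrivals A f p R ω v i ≠ none then
    A.send (f v) (ω v) (decide (v ∈ R)) [arrivals A f p R ω v] else fun _ => none

/-- The number of messages that `v` sends in the second round if the set of roots is `R`. -/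
noncomputable def secondCount (A : Algorithm n ID Msg) (f : Fin n → ID) (p : PortMapping n)
    (R : Finset (Fin n)) (ω : Fin n → A.Coin) (v : Fin n) : ℕ :=
  numSent (secondOut A f p R ω v)

/-- The node `w`, if it is a root, sends a message to `v` in the first round. -/
def SendsTo (A : Algorithm n ID Msg) (f : Fin n → ID) (p : PortMapping n)
    (ω : Fin n → A.Coin) (w v : Fin n) : Prop :=
  ∃ i, (p.neighbor w i : Fin n) = v ∧ A.send (f w) (ω w) true [] i ≠ none

variable (A : Algorithm n ID Msg)

theorem outbox_nil (S : Adversary n ID) (u : Fin n) (c : A.Coin) [Decidable (u ∈ S.roots)] :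
    outbox A S u c [] = if u ∈ S.roots then A.send (S.id u) c true [] else fun _ => none := by
  by_cases h : u ∈ S.roots <;> simp [outbox, Awake, h]

theorem history_one (S : Adversary n ID) (ω : Fin n → A.Coin) (u : Fin n) :
    history A S ω 1 u = [arrivals A S.id S.ports S.roots ω u] := by
  classical
  simp only [history, List.nil_append, List.cons.injEq, and_true]
  funext i
  rw [outbox_nil, arrivals]
  split_ifs <;> rfl

theorem outbox_history_one (S : Adversary n ID) (ω : Fin n → A.Coin) (u : Fin n) :
    outbox A S u (ω u) (history A S ω 1 u) = secondOut A S.id S.ports S.roots ω u := by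
  rw [history_one, outbox, secondOut]
  simp [Awake]

theorem messageCount_two (S : Adversary n ID) (ω : Fin n → A.Coin) :
    messageCount A S 2 ω = ∑ u ∈ S.roots, firstCount A (S.id u) (ω u) +
      ∑ v, secondCount A S.id S.ports S.roots ω v := by
  classical
  have h0 : ∑ u, numSent (outbox A S u (ω u) (history A S ω 0 u)) =
      ∑ u ∈ S.roots, firstCount A (S.id u) (ω u) := by
    rw [← Finset.sum_subset (Finset.subset_univ S.roots)]
    · refine Finset.sum_congr rfl fun u hu => ?_
      rw [history, outbox_nil, if_pos hu, firstCount]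
    · intro u _ hu
      rw [history, outbox_nil, if_neg hu, numSent_none]
  have h1 : ∑ u, numSent (outbox A S u (ω u) (history A S ω 1 u)) =
      ∑ v, secondCount A S.id S.ports S.roots ω v :=
    Finset.sum_congr rfl fun u _ => by rw [outbox_history_one, secondCount]
  rw [← h0, ← h1]
  exact Finset.sum_range_succ _ 1 |>.trans (by rw [Finset.sum_range_one]; rfl)

/-- Every message sent in a round arrives in that round. -/
theorem sum_numSent_link (p : PortMapping n) (out : Fin n → PortMessages n Msg) :
    ∑ v, numSent (fun i => out (p.link (v, i)).1 (p.link (v, i)).2) = ∑ v, numSent (out v) := by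
  classical
  have key : ∀ g : Fin n → PortMessages n Msg,
      ∑ v, numSent (g v) = ∑ x : Fin n × Fin (n - 1), if g x.1 x.2 ≠ none then 1 else 0 := by
    intro g
    rw [Fintype.sum_prod_type]
    refine Finset.sum_congr rfl fun v _ => ?_
    rw [numSent, Finset.card_filter]
  rw [key, key]
  exact Equiv.sum_comp (Function.Involutive.toPerm p.link p.link_link)
    fun x => if out x.1 x.2 ≠ none then 1 else 0

theorem numSent_pos {out : PortMessages n Msg} {i : Fin (n - 1)} (h : out i ≠ none) :
    1 ≤ numSent out :=
  Finset.card_pos.2 ⟨i, by simpa using h⟩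

theorem exists_arrived_of_mem_history (S : Adversary n ID) (ω : Fin n → A.Coin) (u : Fin n)
    (T : ℕ) (a : PortMessages n Msg) (ha : a ∈ history A S ω T u) :
    ∃ r < T, a = fun i => outbox A S (S.ports.link (u, i)).1 (ω (S.ports.link (u, i)).1)
        (history A S ω r (S.ports.link (u, i)).1) (S.ports.link (u, i)).2 := by
  induction T with
  | zero => simp [history] at ha
  | succ T ih =>
    rw [history, List.mem_append, List.mem_singleton] at ha
    rcases ha with ha | ha
    · obtain ⟨r, hr, h⟩ := ih ha
      exact ⟨r, by omega, h⟩
    · exact ⟨T, by omega, ha⟩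

/-- Every node that is not a root has to receive a message in order to wake up. -/
theorem card_sub_card_roots_le_messageCount (S : Adversary n ID) (T : ℕ) (ω : Fin n → A.Coin)
    (h : AllAwake A S T ω) : n - S.roots.card ≤ messageCount A S T ω := by
  classical
  -- Count each message at its receiver instead of its sender.
  have hc : messageCount A S T ω = ∑ v, ∑ r ∈ Finset.range T,
      numSent (fun i => outbox A S (S.ports.link (v, i)).1 (ω (S.ports.link (v, i)).1)
        (history A S ω r (S.ports.link (v, i)).1) (S.ports.link (v, i)).2) := by
    rw [Finset.sum_comm]
    refine Finset.sum_congr rfl fun r _ => ?_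
    exact (sum_numSent_link S.ports fun u => outbox A S u (ω u) (history A S ω r u)).symm
  have hcard : n - S.roots.card = ∑ v ∈ S.rootsᶜ, 1 := by
    rw [Finset.sum_const, Finset.card_compl]; simp
  rw [hc, hcard]
  refine (Finset.sum_le_sum fun v hv => ?_).trans
    (Finset.sum_le_sum_of_subset (Finset.subset_univ _))
  obtain hv' | ⟨a, ha, i, hi⟩ := h v
  · exact absurd hv' (Finset.mem_compl.1 hv)
  · obtain ⟨r, hr, rfl⟩ := exists_arrived_of_mem_history A S ω v T a ha
    refine (numSent_pos (out := fun i =>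
      outbox A S (S.ports.link (v, i)).1 (ω (S.ports.link (v, i)).1)
        (history A S ω r (S.ports.link (v, i)).1) (S.ports.link (v, i)).2) hi).trans ?_
    exact Finset.single_le_sum (f := fun r => numSent (fun i =>
      outbox A S (S.ports.link (v, i)).1 (ω (S.ports.link (v, i)).1)
        (history A S ω r (S.ports.link (v, i)).1) (S.ports.link (v, i)).2))
      (fun _ _ => Nat.zero_le _) (Finset.mem_range.2 hr)

theorem PortMapping.neighbor_link (p : PortMapping n) (v : Fin n) (i : Fin (n - 1)) :
    (p.neighbor (p.link (v, i)).1 (p.link (v, i)).2 : Fin n) = v :=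
  congrArg Prod.fst (p.link_link (v, i))

variable (f : Fin n → ID) (p : PortMapping n) (ω : Fin n → A.Coin)

theorem arrivals_ne_none {R : Finset (Fin n)} {v : Fin n} {i : Fin (n - 1)}
    (h : arrivals A f p R ω v i ≠ none) :
    (p.link (v, i)).1 ∈ R ∧ SendsTo A f p ω (p.link (v, i)).1 v := by
  rw [arrivals] at h
  split_ifs at h with hR
  · exact ⟨hR, _, p.neighbor_link v i, h⟩
  · exact absurd rfl h

/-- A node other than the only root is still asleep in round 2 unless that root reached it. -/
theorem sendsTo_of_secondCount_ne_zero {u v : Fin n} (huv : v ≠ u)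
    (h : secondCount A f p {u} ω v ≠ 0) : SendsTo A f p ω u v := by
  by_contra hs
  apply h
  rw [secondCount, secondOut, if_neg, numSent_none]
  rintro (hv | ⟨i, hi⟩)
  · exact huv (Finset.mem_singleton.1 hv)
  · obtain ⟨hR, hi⟩ := arrivals_ne_none A f p ω hi
    rw [Finset.mem_singleton.1 hR] at hi
    exact hs hi

/-- A node that hears from no root but `u` acts as if `u` were the only root. -/
theorem secondCount_eq_singleton {R : Finset (Fin n)} {u v : Fin n} (hu : u ∈ R)
    (hv : v ∉ R.erase u) (h : ∀ w ∈ R.erase u, ¬ SendsTo A f p ω w v) :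
    secondCount A f p R ω v = secondCount A f p {u} ω v := by
  have hvR : v ∈ R ↔ v ∈ ({u} : Finset (Fin n)) := by
    rw [Finset.mem_singleton]
    constructor
    · intro h1
      by_contra h2
      exact hv (Finset.mem_erase.2 ⟨h2, h1⟩)
    · rintro rfl
      exact hu
  have harr : arrivals A f p R ω v = arrivals A f p {u} ω v := by
    funext i
    by_cases hi : (p.link (v, i)).1 = u
    · simp [arrivals, hi, hu]
    · have h2 : arrivals A f p {u} ω v i = none := by simp [arrivals, hi]
      rw [h2]
      by_contra h3
      obtain ⟨h4, h5⟩ := arrivals_ne_none A f p ω h3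
      exact h _ (Finset.mem_erase.2 ⟨hi, h4⟩) h5
  simp only [secondCount, secondOut, harr, hvR]

-- At most one summand is nonzero. If the condition holds for `u`, then `v` is no other root and
-- hears from no other root `u'`, so it would be silent if `u'` were alone. The surviving summand is
-- the true count by `secondCount_eq_singleton`.
open Classical in
theorem sum_secondCount_singleton_le (R : Finset (Fin n)) (v : Fin n) :
    ∑ u ∈ R, (if v ∉ R.erase u ∧ ∀ w ∈ R.erase u, ¬ SendsTo A f p ω w v then
      secondCount A f p {u} ω v else 0) ≤ secondCount A f p R ω v := by
  by_cases h : ∃ u ∈ R, (if v ∉ R.erase u ∧ ∀ w ∈ R.erase u, ¬ SendsTo A f p ω w v then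
      secondCount A f p {u} ω v else 0) ≠ 0
  · obtain ⟨u, hu, h0⟩ := h
    have hc : v ∉ R.erase u ∧ ∀ w ∈ R.erase u, ¬ SendsTo A f p ω w v := by
      by_contra hc
      exact h0 (if_neg hc)
    rw [Finset.sum_eq_single u, if_pos hc, secondCount_eq_singleton A f p ω hu hc.1 hc.2]
    · intro u' hu' hne
      by_contra h1
      have hc' : v ∉ R.erase u' ∧ ∀ w ∈ R.erase u', ¬ SendsTo A f p ω w v := by
        by_contra hc
        exact h1 (if_neg hc)
      rw [if_pos hc'] at h1
      have hvu' : v ≠ u' := fun e => hc.1 (Finset.mem_erase.2 ⟨e ▸ hne, e ▸ hu'⟩)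
      exact hc.2 u' (Finset.mem_erase.2 ⟨hne, hu'⟩)
        (sendsTo_of_secondCount_ne_zero A f p ω hvu' h1)
    · exact fun h => absurd hu h
  · push Not at h
    rw [Finset.sum_eq_zero h]
    exact Nat.zero_le _

end Deterministic

/-! ### Measurability by fibres, independence, and averaging over permutations -/

section Probability

open ProbabilityTheory

/-- A map whose fibres are measurable. -/
def FiberMeasurable {α β : Type*} [MeasurableSpace α] (f : α → β) : Prop :=
  ∀ y, MeasurableSet (f ⁻¹' {y})

namespace FiberMeasurable

variable {α β γ : Type*} [MeasurableSpace α]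

theorem preimage [Countable β] {f : α → β} (hf : FiberMeasurable f) (s : Set β) :
    MeasurableSet (f ⁻¹' s) := by
  rw [← Set.biUnion_preimage_singleton]
  exact MeasurableSet.biUnion s.to_countable fun y _ => hf y

theorem measurable [Countable β] [MeasurableSpace β] {f : α → β} (hf : FiberMeasurable f) :
    Measurable f :=
  fun s _ => hf.preimage s

/-- Needed because round 2 depends on the coins both directly and through the arrivals of round 1:
one splits over the countably many values of the latter. -/
theorem bind [Countable β] {f : α → β} {g : β → α → γ} (hf : FiberMeasurable f)
    (hg : ∀ b, FiberMeasurable (g b)) : FiberMeasurable fun x => g (f x) x := by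
  intro y
  have h : (fun x => g (f x) x) ⁻¹' {y} = ⋃ b, f ⁻¹' {b} ∩ g b ⁻¹' {y} := by
    ext x
    simp
  rw [h]
  exact MeasurableSet.iUnion fun b => (hf b).inter (hg b y)

theorem const (b : β) : FiberMeasurable fun _ : α => b :=
  fun _ => MeasurableSet.const _

theorem comp [Countable β] {f : α → β} (hf : FiberMeasurable f) (g : β → γ) :
    FiberMeasurable fun x => g (f x) :=
  hf.bind fun b => const (g b)

theorem pi {ι : Type*} [Countable ι] {β : ι → Type*} {f : (i : ι) → α → β i}
    (hf : ∀ i, FiberMeasurable (f i)) : FiberMeasurable fun x i => f i x := by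
  intro y
  have h : (fun x i => f i x) ⁻¹' {y} = ⋂ i, f i ⁻¹' {y i} := by
    ext x
    simp [funext_iff]
  rw [h]
  exact MeasurableSet.iInter fun i => hf i (y i)

theorem integrable_natCast {f : α → ℕ} (hf : FiberMeasurable f) {N : ℕ} (hN : ∀ x, f x ≤ N)
    (μ : Measure α) [IsFiniteMeasure μ] : Integrable (fun x => (f x : ℝ)) μ := by
  refine Integrable.of_bound (C := N) ?_ ?_
  · exact (measurable_from_nat.comp hf.measurable).aestronglyMeasurable
  · exact Filter.Eventually.of_forall fun x => by simpa using hN x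

end FiberMeasurable

/-- Each function factors through the restriction to its own coordinates, and restrictions to
disjoint sets of coordinates are independent under a product measure. -/
theorem indepFun_of_dependsOn {ι α β γ : Type*} [Fintype ι] [MeasurableSpace α]
    [MeasurableSpace β] [MeasurableSpace γ] (μ : Measure α) [IsProbabilityMeasure μ]
    {f : (ι → α) → β} {g : (ι → α) → γ} (hf : Measurable f) (hg : Measurable g)
    {S T : Finset ι} (hST : Disjoint S T) (hfS : DependsOn f S) (hgT : DependsOn g T) :
    IndepFun f g (Measure.pi fun _ : ι => μ) := by
  classical
  obtain ⟨a⟩ := μ.nonempty_of_neZero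
  -- Fill the missing coordinates with an arbitrary point `a`; the function does not see them.
  let ext (S : Finset ι) (y : S → α) (i : ι) : α := if h : i ∈ S then y ⟨i, h⟩ else a
  have hext : ∀ S, Measurable (ext S) := by
    refine fun S => measurable_pi_lambda _ fun i => ?_
    by_cases h : i ∈ S
    · simpa [ext, h] using measurable_pi_apply (⟨i, h⟩ : S)
    · simp [ext, h]
  have hf' : f = (f ∘ ext S) ∘ fun x (i : S) => x i :=
    funext fun x => hfS fun i hi => by simp [ext, Finset.mem_coe.1 hi]
  have hg' : g = (g ∘ ext T) ∘ fun x (i : T) => x i :=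
    funext fun x => hgT fun i hi => by simp [ext, Finset.mem_coe.1 hi]
  have hi : iIndepFun (fun (i : ι) (x : ι → α) => x i) (Measure.pi fun _ : ι => μ) :=
    iIndepFun_pi (X := fun _ => id) fun _ => aemeasurable_id
  rw [hf', hg']
  exact (hi.indepFun_finset S T hST fun i => measurable_pi_apply i).comp
    (hf.comp (hext S)) (hg.comp (hext T))

/-- Composing with a transposition shows that the left sum does not depend on `k`; summing over all
`k` then gives `∑ i, F i` for every permutation. -/
theorem card_mul_sum_perm {m : ℕ} (F : Fin m → ℝ) (k : Fin m) :
    (m : ℝ) * ∑ σ : Equiv.Perm (Fin m), F (σ.symm k) =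
      Fintype.card (Equiv.Perm (Fin m)) * ∑ i, F i := by
  have h : ∀ k', ∑ σ : Equiv.Perm (Fin m), F (σ.symm k') =
      ∑ σ : Equiv.Perm (Fin m), F (σ.symm k) := by
    intro k'
    rw [← Equiv.sum_comp (Equiv.mulLeft (Equiv.swap k k'))
      fun σ : Equiv.Perm (Fin m) => F (σ.symm k')]
    refine Finset.sum_congr rfl fun σ _ => congrArg F ?_
    simp [Equiv.symm_apply_eq]
  calc (m : ℝ) * ∑ σ : Equiv.Perm (Fin m), F (σ.symm k)
      = ∑ k', ∑ σ : Equiv.Perm (Fin m), F (σ.symm k') := by simp [h]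
    _ = ∑ σ : Equiv.Perm (Fin m), ∑ i, F i := by
      rw [Finset.sum_comm]
      exact Finset.sum_congr rfl fun σ _ => Equiv.sum_comp σ.symm F
    _ = _ := by simp

end Probability

/-! ### The product space of random ports and coins -/

section RandomPorts

variable {n : ℕ} {ID Msg : Type}

instance instMeasurableSpacePermFin (m : ℕ) : MeasurableSpace (Equiv.Perm (Fin m)) := ⊤

instance instDiscreteMeasurableSpacePermFin (m : ℕ) :
    DiscreteMeasurableSpace (Equiv.Perm (Fin m)) := ⟨fun _ => trivial⟩

/-- Some port numbering at the node `u`. -/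
noncomputable def basePorts (u : Fin n) : Fin (n - 1) ≃ {v : Fin n // v ≠ u} :=
  (Fintype.equivFinOfCardEq (by simp [Fintype.card_subtype_compl])).symm

/-- The port mapping obtained by permuting the ports of every node. -/
noncomputable def permutedPorts (σ : Fin n → Equiv.Perm (Fin (n - 1))) : PortMapping n :=
  ⟨fun u => (σ u).trans (basePorts u)⟩

/-- The uniform distribution on the permutations of the ports of a node. -/
noncomputable def permLaw (n : ℕ) : Measure (Equiv.Perm (Fin (n - 1))) :=
  (PMF.uniformOfFintype (Equiv.Perm (Fin (n - 1)))).toMeasure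

instance instIsProbabilityMeasurePermLaw : IsProbabilityMeasure (permLaw n) :=
  PMF.toMeasure.isProbabilityMeasure _

theorem integral_permLaw (F : Equiv.Perm (Fin (n - 1)) → ℝ) :
    ∫ σ, F σ ∂(permLaw n) = (Fintype.card (Equiv.Perm (Fin (n - 1))) : ℝ)⁻¹ * ∑ σ, F σ := by
  rw [permLaw, PMF.integral_eq_sum, Finset.mul_sum]
  simp

/-- The port permutations and the coins of all nodes. -/
abbrev Setup (A : Algorithm n ID Msg) : Type :=
  Fin n → Equiv.Perm (Fin (n - 1)) × A.Coin

variable (A : Algorithm n ID Msg)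

instance instIsProbabilityMeasureCoinLaw : IsProbabilityMeasure (coinLaw A) := by
  unfold coinLaw; infer_instance

/-- Uniformly random ports and independent coins. -/
noncomputable def setupLaw : Measure (Setup A) :=
  Measure.pi fun _ => (permLaw n).prod A.law

instance instIsProbabilityMeasureSetupLaw : IsProbabilityMeasure (setupLaw A) := by
  unfold setupLaw; infer_instance

variable {A}

/-- The port mapping of a setup. -/
noncomputable def Setup.ports (x : Setup A) : PortMapping n :=
  permutedPorts fun u => (x u).1

/-- The coins of a setup. -/
def Setup.coins (x : Setup A) : Fin n → A.Coin := fun u => (x u).2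

/-- Fubini, after regrouping the per-node pairs. It separates the ports, which will be fixed by
averaging, from the coins. -/
theorem integral_setupLaw {F : (Fin n → Equiv.Perm (Fin (n - 1))) → (Fin n → A.Coin) → ℝ}
    (hF : Integrable (fun x : Setup A => F (fun u => (x u).1) (fun u => (x u).2))
      (setupLaw A)) :
    ∫ x : Setup A, F (fun u => (x u).1) (fun u => (x u).2) ∂(setupLaw A) =
      ∫ σ, ∫ ω, F σ ω ∂(coinLaw A) ∂(Measure.pi fun _ : Fin n => permLaw n) := by
  have hp := measurePreserving_arrowProdEquivProdArrow (Equiv.Perm (Fin (n - 1))) A.Coin (Fin n)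
    (fun _ => permLaw n) (fun _ => A.law)
  have hi : Integrable (fun y : (Fin n → Equiv.Perm (Fin (n - 1))) × (Fin n → A.Coin) =>
      F y.1 y.2) ((Measure.pi fun _ : Fin n => permLaw n).prod (coinLaw A)) :=
    (hp.integrable_comp_emb (MeasurableEquiv.measurableEmbedding _)).1 hF
  rw [← integral_prod _ hi]
  exact hp.integral_comp (MeasurableEquiv.measurableEmbedding _)
    fun y : (Fin n → Equiv.Perm (Fin (n - 1))) × (Fin n → A.Coin) => F y.1 y.2

theorem integral_setupLaw_eval (u : Fin n) {F : Equiv.Perm (Fin (n - 1)) × A.Coin → ℝ}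
    (hF : Measurable F) :
    ∫ x : Setup A, F (x u) ∂(setupLaw A) = ∫ y, F y ∂((permLaw n).prod A.law) := by
  have h := measurePreserving_eval (fun _ : Fin n => (permLaw n).prod A.law) u
  rw [← h.map_eq, integral_map h.aemeasurable hF.aestronglyMeasurable]
  rfl

theorem fiberMeasurable_perms : FiberMeasurable fun (x : Setup A) u => (x u).1 :=
  FiberMeasurable.pi fun u y => by
    have : Measurable fun x : Setup A => (x u).1 := measurable_fst.comp (measurable_pi_apply u)
    exact this (MeasurableSet.of_discrete)

theorem measurable_coins : Measurable fun (x : Setup A) u => (x u).2 :=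
  measurable_pi_lambda _ fun u => measurable_snd.comp (measurable_pi_apply u)

theorem FiberMeasurable.setup {β : Type*}
    {F : (Fin n → Equiv.Perm (Fin (n - 1))) → (Fin n → A.Coin) → β}
    (hF : ∀ σ, FiberMeasurable (F σ)) :
    FiberMeasurable fun x : Setup A => F (fun u => (x u).1) (fun u => (x u).2) :=
  fiberMeasurable_perms.bind (g := fun σ (x : Setup A) => F σ (fun u => (x u).2))
    fun σ y => measurable_coins (hF σ y)

end RandomPorts

/-! ### Measurability and integrability of the message counts -/

section Measurability

variable {n : ℕ} {ID Msg : Type} (A : Algorithm n ID Msg) (f : Fin n → ID) (p : PortMapping n)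

theorem fiberMeasurable_send (i : ID) (b : Bool) (h : List (PortMessages n Msg)) :
    FiberMeasurable fun c => A.send i c b h :=
  fun out => A.measurableSet_send i b h out

theorem fiberMeasurable_send_coins (u : Fin n) (b : Bool) (h : List (PortMessages n Msg)) :
    FiberMeasurable fun ω : Fin n → A.Coin => A.send (f u) (ω u) b h :=
  fun out => (measurable_pi_apply u : Measurable fun ω : Fin n → A.Coin => ω u)
    (A.measurableSet_send (f u) b h out)

variable [Countable Msg]

theorem fiberMeasurable_firstCount (i : ID) : FiberMeasurable (firstCount A i) :=
  (fiberMeasurable_send A i true []).comp numSent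

theorem fiberMeasurable_arrivals (R : Finset (Fin n)) (v : Fin n) :
    FiberMeasurable fun ω => arrivals A f p R ω v := by
  classical
  refine FiberMeasurable.pi fun i => ?_
  by_cases h : (p.link (v, i)).1 ∈ R
  · simp only [arrivals, h, if_true]
    exact (fiberMeasurable_send_coins A f _ true []).comp fun out => out (p.link (v, i)).2
  · simp only [arrivals, h, if_false]
    exact FiberMeasurable.const none

theorem fiberMeasurable_secondCount (R : Finset (Fin n)) (v : Fin n) :
    FiberMeasurable fun ω => secondCount A f p R ω v := by
  classical
  suffices hbind : ∀ a : PortMessages n Msg, FiberMeasurable fun ω : Fin n → A.Coin => numSent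
      (if v ∈ R ∨ ∃ i, a i ≠ none then A.send (f v) (ω v) (decide (v ∈ R)) [a]
        else fun _ => none) by
    exact (fiberMeasurable_arrivals A f p R v).bind hbind
  intro a
  by_cases h : v ∈ R ∨ ∃ i, a i ≠ none
  · simp only [h, if_true]
    exact (fiberMeasurable_send_coins A f v _ _).comp numSent
  · simp only [h, if_false]
    exact FiberMeasurable.const _

theorem fiberMeasurable_sendsTo (w v : Fin n) :
    FiberMeasurable fun ω => SendsTo A f p ω w v :=
  (fiberMeasurable_send_coins A f w true []).comp
    fun out => ∃ i, (p.neighbor w i : Fin n) = v ∧ out i ≠ none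

theorem fiberMeasurable_secondCount_setup (R : Finset (Fin n)) (v : Fin n) :
    FiberMeasurable fun x : Setup A => secondCount A f x.ports R x.coins v :=
  FiberMeasurable.setup (F := fun σ ω => secondCount A f (permutedPorts σ) R ω v)
    fun σ => fiberMeasurable_secondCount A f (permutedPorts σ) R v

theorem integrable_secondCount_setup (R : Finset (Fin n)) (v : Fin n) :
    Integrable (fun x : Setup A => (secondCount A f x.ports R x.coins v : ℝ)) (setupLaw A) :=
  (fiberMeasurable_secondCount_setup A f R v).integrable_natCast (fun _ => numSent_le _) _

theorem integrable_secondCount (R : Finset (Fin n)) (v : Fin n) :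
    Integrable (fun ω => (secondCount A f p R ω v : ℝ)) (coinLaw A) :=
  (fiberMeasurable_secondCount A f p R v).integrable_natCast (fun _ => numSent_le _) _

theorem integrable_firstCount (i : ID) :
    Integrable (fun c => (firstCount A i c : ℝ)) A.law :=
  (fiberMeasurable_firstCount A i).integrable_natCast (fun _ => numSent_le _) _

theorem measurableSet_sendsTo_setup (w v : Fin n) :
    MeasurableSet {x : Setup A | SendsTo A f x.ports x.coins w v} := by
  have h := FiberMeasurable.setup (A := A) (F := fun σ ω => SendsTo A f (permutedPorts σ) ω w v)
    (fun σ => fiberMeasurable_sendsTo A f (permutedPorts σ) w v) True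
  convert h using 1
  ext x
  rw [Set.mem_preimage, Set.mem_singleton_iff, eq_iff_iff, iff_true]
  rfl

end Measurability

/-! ### Expected message counts and the probability of reaching a node -/

section Expectation

variable {n : ℕ} {ID Msg : Type} (A : Algorithm n ID Msg) (f : Fin n → ID)

/-- The expected number of messages that a root with ID `i` sends in the first round. -/
noncomputable def meanFirst (i : ID) : ℝ := ∫ c, (firstCount A i c : ℝ) ∂A.law

theorem meanFirst_nonneg (i : ID) : 0 ≤ meanFirst A i :=
  integral_nonneg fun _ => Nat.cast_nonneg _

theorem sendsTo_setup_iff (x : Setup A) {w v : Fin n} (hvw : v ≠ w) :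
    SendsTo A f x.ports x.coins w v ↔
      A.send (f w) (x w).2 true [] ((x w).1.symm ((basePorts w).symm ⟨v, hvw⟩)) ≠ none := by
  constructor
  · rintro ⟨i, hi, h⟩
    have h1 : basePorts w ((x w).1 i) = ⟨v, hvw⟩ := Subtype.ext hi
    rw [← h1, Equiv.symm_apply_apply, Equiv.symm_apply_apply]
    exact h
  · intro h
    refine ⟨_, ?_, h⟩
    simp [Setup.ports, permutedPorts]

theorem dependsOn_sendsTo_setup (w v : Fin n) :
    DependsOn (fun x : Setup A => SendsTo A f x.ports x.coins w v) {w} := by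
  intro x y h
  have hw : x w = y w := h w rfl
  simp only [SendsTo, Setup.ports, permutedPorts, Setup.coins, hw]

theorem arrivals_singleton (p : PortMapping n) (ω : Fin n → A.Coin) (u v : Fin n)
    (hvu : v ≠ u) (i : Fin (n - 1)) [Decidable ((p.neighbor v i : Fin n) = u)] :
    arrivals A f p {u} ω v i = if (p.neighbor v i : Fin n) = u then
      A.send (f u) (ω u) true [] ((p.neighbor u).symm ⟨v, hvu⟩) else none := by
  rw [arrivals]
  have h1 : (p.link (v, i)).1 = p.neighbor v i := rfl
  by_cases h : (p.neighbor v i : Fin n) = u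
  · have h2 : (p.link (v, i)).2 = (p.neighbor u).symm ⟨v, hvu⟩ := by
      subst h
      rfl
    rw [if_pos (by rw [h1, h]; simp), if_pos h, h2, h1, h]
  · rw [if_neg (by rw [h1]; simpa using h), if_neg h]

theorem arrivals_singleton_self (p : PortMapping n) (ω : Fin n → A.Coin) (u : Fin n) :
    arrivals A f p {u} ω u = fun _ => none := by
  funext i
  rw [arrivals, if_neg]
  exact fun h => (p.neighbor u i).2 (Finset.mem_singleton.1 h)

/-- The setup of `u` decides whether and what it sends to `v`; the setup of `v` decides over which
port this arrives and how `v` reacts. -/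
theorem dependsOn_secondCount_setup (u v : Fin n) :
    DependsOn (fun x : Setup A => secondCount A f x.ports {u} x.coins v)
      (({u, v} : Finset (Fin n)) : Set (Fin n)) := by
  classical
  rintro (x : Setup A) (y : Setup A) h
  change secondCount A f x.ports {u} x.coins v = secondCount A f y.ports {u} y.coins v
  have hu : x u = y u := h u (by simp)
  have hv : x v = y v := h v (by simp)
  have ha : arrivals A f x.ports {u} x.coins v = arrivals A f y.ports {u} y.coins v := by
    by_cases hvu : v = u
    · subst hvu
      simp only [arrivals_singleton_self]
    · funext i
      rw [arrivals_singleton A f _ _ u v hvu, arrivals_singleton A f _ _ u v hvu]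
      simp only [Setup.ports, permutedPorts, Setup.coins, hu, hv]
      congr
  have hc : x.coins v = y.coins v := congrArg Prod.snd hv
  simp only [secondCount, secondOut, ha, hc]

/-- Markov's inequality: waking everybody costs at least one message per non-root. -/
theorem le_expectedMessages_of_wakesUpAll {T : ℕ} {ε : ℝ} (h : WakesUpAll A T ε)
    (S : Adversary n ID) (hi : Integrable (fun ω => (messageCount A S T ω : ℝ)) (coinLaw A)) :
    (1 - ε) * ((n - S.roots.card : ℕ) : ℝ) ≤ expectedMessages A S T := by
  have h1 := mul_meas_ge_le_integral_of_nonneg (μ := coinLaw A)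
    (f := fun ω => (messageCount A S T ω : ℝ))
    (Filter.Eventually.of_forall fun _ => Nat.cast_nonneg _) hi ((n - S.roots.card : ℕ) : ℝ)
  refine le_trans ?_ h1
  rw [mul_comm]
  refine mul_le_mul_of_nonneg_left ((h S).trans (measureReal_mono ?_)) (Nat.cast_nonneg _)
  intro ω hω
  rw [Set.mem_ofPred_eq]
  exact Nat.cast_le.2 (card_sub_card_roots_le_messageCount A S T ω hω)

variable [Countable Msg]

/-- The port over which a root reaches a given node is uniformly distributed. -/
theorem measureReal_sendsTo {w v : Fin n} (hvw : v ≠ w) :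
    ((n - 1 : ℕ) : ℝ) * (setupLaw A).real {x | SendsTo A f x.ports x.coins w v} =
      meanFirst A (f w) := by
  classical
  set k := (basePorts w).symm ⟨v, hvw⟩ with hk
  let E : Set (Equiv.Perm (Fin (n - 1)) × A.Coin) :=
    {y | A.send (f w) y.2 true [] (y.1.symm k) ≠ none}
  have hE : MeasurableSet E := by
    have h1 : FiberMeasurable fun y : Equiv.Perm (Fin (n - 1)) × A.Coin => y.1 :=
      fun σ => measurable_fst (MeasurableSet.of_discrete)
    have h2 : ∀ σ : Equiv.Perm (Fin (n - 1)),
        FiberMeasurable fun y : Equiv.Perm (Fin (n - 1)) × A.Coin =>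
          A.send (f w) y.2 true [] (σ.symm k) := fun σ =>
      FiberMeasurable.comp (f := fun y : Equiv.Perm (Fin (n - 1)) × A.Coin =>
        A.send (f w) y.2 true [])
        (fun out => measurable_snd (A.measurableSet_send (f w) true [] out))
        fun out => out (σ.symm k)
    exact (h1.bind h2).preimage {none}ᶜ
  have hpre : {x : Setup A | SendsTo A f x.ports x.coins w v} = {x | x w ∈ E} := by
    ext x
    exact sendsTo_setup_iff A f x hvw
  have hmeas : MeasurableSet {x : Setup A | x w ∈ E} := measurable_pi_apply w hE
  have hF : Measurable (E.indicator fun _ => (1 : ℝ)) := measurable_const.indicator hE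
  have h1 : (setupLaw A).real {x | SendsTo A f x.ports x.coins w v} =
      ∫ y, E.indicator (fun _ => (1 : ℝ)) y ∂((permLaw n).prod A.law) := by
    rw [← integral_setupLaw_eval w hF, hpre, ← integral_indicator_one hmeas]
    rfl
  have hint : Integrable (E.indicator fun _ => (1 : ℝ)) ((permLaw n).prod A.law) :=
    (integrable_const (1 : ℝ)).indicator hE
  -- For fixed coins `c` of `w`, average over its permutation: the port leading to `v` is uniform
  -- among `n - 1` ports, of which `firstCount` are used.
  rw [h1, integral_prod_symm _ hint, ← integral_const_mul, meanFirst]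
  congr 1
  funext c
  let q : Fin (n - 1) → ℝ := fun i => if A.send (f w) c true [] i ≠ none then 1 else 0
  have hq : ∀ σ : Equiv.Perm (Fin (n - 1)),
      E.indicator (fun _ => (1 : ℝ)) (σ, c) = q (σ.symm k) := by
    intro σ
    simp only [Set.indicator, E, Set.mem_ofPred_eq, q]
  have hs : ∑ i, q i = firstCount A (f w) c := by
    rw [firstCount, numSent, Finset.card_filter, Nat.cast_sum]
    refine Finset.sum_congr rfl fun i _ => ?_
    simp only [q]
    split_ifs <;> simp
  simp only [hq]
  rw [integral_permLaw, mul_left_comm, card_mul_sum_perm, hs, inv_mul_cancel_left₀]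
  simp

theorem integral_firstCount_coins (u : Fin n) :
    ∫ ω : Fin n → A.Coin, (firstCount A (f u) (ω u) : ℝ) ∂(coinLaw A) = meanFirst A (f u) := by
  have h := measurePreserving_eval (fun _ : Fin n => A.law) u
  rw [meanFirst, ← h.map_eq, integral_map h.aemeasurable]
  · rfl
  · rw [h.map_eq]
    exact (integrable_firstCount A (f u)).aestronglyMeasurable

theorem integrable_firstCount_coins (u : Fin n) :
    Integrable (fun ω : Fin n → A.Coin => (firstCount A (f u) (ω u) : ℝ)) (coinLaw A) :=
  ((fiberMeasurable_send_coins A f u true []).comp numSent).integrable_natCast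
    (fun _ => numSent_le _) _

theorem expectedMessages_two (S : Adversary n ID) :
    expectedMessages A S 2 = ∑ u ∈ S.roots, meanFirst A (S.id u) +
      ∑ v, ∫ ω, (secondCount A S.id S.ports S.roots ω v : ℝ) ∂(coinLaw A) := by
  simp only [expectedMessages, messageCount_two, Nat.cast_add, Nat.cast_sum]
  rw [integral_add (integrable_finsetSum _ fun u _ => integrable_firstCount_coins A S.id u)
    (integrable_finsetSum _ fun v _ => integrable_secondCount A S.id S.ports S.roots v),
    integral_finsetSum _ fun u _ => integrable_firstCount_coins A S.id u,
    integral_finsetSum _ fun v _ => integrable_secondCount A S.id S.ports S.roots v]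
  congr 1
  exact Finset.sum_congr rfl fun u _ => integral_firstCount_coins A S.id u

end Expectation

/-! ### Superposing the executions with a single root -/

section RandomRoots

open ProbabilityTheory

variable {n : ℕ} {ID Msg : Type} (A : Algorithm n ID Msg) (f : Fin n → ID)

/-- The expected number of messages that `v` sends in the second round if the set of roots is `R`
and the ports are uniformly random. -/
noncomputable def meanSecond (R : Finset (Fin n)) (v : Fin n) : ℝ :=
  ∫ x : Setup A, (secondCount A f x.ports R x.coins v : ℝ) ∂(setupLaw A)

theorem meanSecond_nonneg (R : Finset (Fin n)) (v : Fin n) : 0 ≤ meanSecond A f R v :=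
  integral_nonneg fun _ => Nat.cast_nonneg _

/-- The setups in which `v` hears from no root in `R`. -/
def unheard (R : Finset (Fin n)) (v : Fin n) : Set (Setup A) :=
  {x | ∀ w ∈ R, ¬ SendsTo A f x.ports x.coins w v}

theorem unheard_eq (R : Finset (Fin n)) (v : Fin n) :
    unheard A f R v = (⋃ w ∈ R, {x : Setup A | SendsTo A f x.ports x.coins w v})ᶜ := by
  ext x
  simp [unheard]

variable [Countable Msg]

theorem sum_meanSecond (R : Finset (Fin n)) :
    ∑ v, meanSecond A f R v = ∫ σ, ∑ v, ∫ ω,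
      (secondCount A f (permutedPorts σ) R ω v : ℝ) ∂(coinLaw A)
        ∂(Measure.pi fun _ : Fin n => permLaw n) := by
  rw [integral_finsetSum _ fun v _ => Integrable.of_finite]
  exact Finset.sum_congr rfl fun v _ => integral_setupLaw
    (F := fun σ ω => (secondCount A f (permutedPorts σ) R ω v : ℝ))
    (integrable_secondCount_setup A f R v)

/-- Some port mapping is at least as expensive as random ports. -/
theorem exists_sum_meanSecond_le_expectedMessages (f : Fin n ↪ ID) {R : Finset (Fin n)}
    (hR : R.Nonempty) :
    ∃ S : Adversary n ID, ∑ v, meanSecond A f R v ≤ expectedMessages A S 2 := by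
  obtain ⟨σ, hσ⟩ := exists_integral_le (μ := Measure.pi fun _ : Fin n => permLaw n)
    (f := fun σ => ∑ v, ∫ ω, (secondCount A f (permutedPorts σ) R ω v : ℝ) ∂(coinLaw A))
    Integrable.of_finite
  refine ⟨⟨f, permutedPorts σ, R, hR⟩, ?_⟩
  rw [sum_meanSecond, expectedMessages_two]
  exact hσ.trans (le_add_of_nonneg_left (Finset.sum_nonneg fun u _ => meanFirst_nonneg A _))

theorem integrable_messageCount_two (S : Adversary n ID) :
    Integrable (fun ω => (messageCount A S 2 ω : ℝ)) (coinLaw A) := by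
  simp only [messageCount_two, Nat.cast_add, Nat.cast_sum]
  exact (integrable_finsetSum _ fun u _ => integrable_firstCount_coins A S.id u).add
    (integrable_finsetSum _ fun v _ => integrable_secondCount A S.id S.ports S.roots v)

/-- The bound holds for each port mapping, since a single root leaves `n - 1` nodes to wake, and
hence on average. -/
theorem le_sum_meanSecond_singleton {ε : ℝ} (h : WakesUpAll A 2 ε) (f : Fin n ↪ ID)
    (u : Fin n) :
    (1 - ε) * ((n - 1 : ℕ) : ℝ) - meanFirst A (f u) ≤ ∑ v, meanSecond A f {u} v := by
  have hσ : ∀ σ : Fin n → Equiv.Perm (Fin (n - 1)),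
      (1 - ε) * ((n - 1 : ℕ) : ℝ) - meanFirst A (f u) ≤
        ∑ v, ∫ ω, (secondCount A f (permutedPorts σ) {u} ω v : ℝ) ∂(coinLaw A) := by
    intro σ
    have h1 := le_expectedMessages_of_wakesUpAll A h
      ⟨f, permutedPorts σ, {u}, Finset.singleton_nonempty u⟩ (integrable_messageCount_two A _)
    rw [expectedMessages_two, Finset.sum_singleton, Finset.card_singleton] at h1
    linarith
  rw [sum_meanSecond]
  have h2 := integral_mono (μ := Measure.pi fun _ : Fin n => permLaw n)
    (integrable_const _) Integrable.of_finite hσ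
  simpa using h2

/-- The node `v` speaks only if `u` reaches it, which has probability `meanFirst / (n - 1)`, and
then sends at most `n - 1` messages. -/
theorem meanSecond_singleton_le {u v : Fin n} (hvu : v ≠ u) :
    meanSecond A f {u} v ≤ meanFirst A (f u) := by
  classical
  have hm := measurableSet_sendsTo_setup A f u v
  rw [← measureReal_sendsTo A f hvu, ← integral_indicator_one hm, ← integral_const_mul]
  refine integral_mono (integrable_secondCount_setup A f {u} v)
    (((integrable_const (1 : ℝ)).indicator hm).const_mul _) fun x => ?_
  by_cases hx : SendsTo A f x.ports x.coins u v
  · have h1 : secondCount A f x.ports {u} x.coins v ≤ n - 1 := numSent_le _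
    simpa [Set.indicator, hx] using h1
  · have h1 : secondCount A f x.ports {u} x.coins v = 0 := by
      by_contra h0
      exact hx (sendsTo_of_secondCount_ne_zero A f _ _ hvu h0)
    simp [Set.indicator, hx, h1]

theorem measurableSet_unheard (R : Finset (Fin n)) (v : Fin n) :
    MeasurableSet (unheard A f R v) := by
  rw [unheard_eq]
  exact (R.measurableSet_biUnion fun w _ => measurableSet_sendsTo_setup A f w v).compl

/-- Union bound: each root of `R` reaches `v` with probability at most `q`. -/
theorem le_measureReal_unheard {R : Finset (Fin n)} {v : Fin n} (hv : v ∉ R) {q : ℝ}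
    (hq : ∀ w ∈ R, meanFirst A (f w) ≤ q * ((n - 1 : ℕ) : ℝ)) (hn : 1 < n) :
    1 - R.card * q ≤ (setupLaw A).real (unheard A f R v) := by
  have hn' : (0 : ℝ) < ((n - 1 : ℕ) : ℝ) := Nat.cast_pos.2 (by omega)
  rw [unheard_eq, probReal_compl_eq_one_sub
    (R.measurableSet_biUnion fun w _ => measurableSet_sendsTo_setup A f w v)]
  refine sub_le_sub_left ((measureReal_biUnion_finset_le _ _).trans ?_) 1
  rw [← nsmul_eq_mul]
  refine Finset.sum_le_card_nsmul _ _ _ fun w hw => ?_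
  have hvw : v ≠ w := fun e => hv (e ▸ hw)
  have h1 := hq w hw
  rw [← measureReal_sendsTo A f hvw, mul_comm] at h1
  exact le_of_mul_le_mul_right h1 hn'

/-- The first factor depends only on the setups of `u` and `v`, the second only on those of `R`, and
these sets of nodes are disjoint. -/
theorem integral_secondCount_mul_unheard {R : Finset (Fin n)} {u v : Fin n} (hu : u ∉ R)
    (hv : v ∉ R) :
    ∫ x : Setup A, (secondCount A f x.ports {u} x.coins v : ℝ) *
      (unheard A f R v).indicator 1 x ∂(setupLaw A) =
        meanSecond A f {u} v * (setupLaw A).real (unheard A f R v) := by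
  classical
  have hm := measurableSet_unheard A f R v
  have hf : Measurable fun x : Setup A => (secondCount A f x.ports {u} x.coins v : ℝ) :=
    measurable_from_nat.comp (fiberMeasurable_secondCount_setup A f {u} v).measurable
  have hg : Measurable ((unheard A f R v).indicator (1 : Setup A → ℝ)) :=
    measurable_one.indicator hm
  have hdf : DependsOn (fun x : Setup A => (secondCount A f x.ports {u} x.coins v : ℝ))
      (({u, v} : Finset (Fin n)) : Set (Fin n)) := fun x y h =>
    congrArg Nat.cast (dependsOn_secondCount_setup A f u v h)
  have hdg : DependsOn ((unheard A f R v).indicator (1 : Setup A → ℝ))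
      (R : Set (Fin n)) := by
    rintro (x : Setup A) (y : Setup A) h
    have h1 : x ∈ unheard A f R v ↔ y ∈ unheard A f R v := by
      refine forall₂_congr fun w hw => not_congr (iff_of_eq ?_)
      refine dependsOn_sendsTo_setup A f w v (x := x) (y := y) fun i hi => h i ?_
      rw [Set.mem_singleton_iff.1 hi]
      exact hw
    by_cases hx : x ∈ unheard A f R v
    · rw [Set.indicator_of_mem hx, Set.indicator_of_mem (h1.1 hx)]
      rfl
    · rw [Set.indicator_of_notMem hx, Set.indicator_of_notMem (mt h1.2 hx)]
  have hdisj : Disjoint ({u, v} : Finset (Fin n)) R := by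
    simp [Finset.disjoint_insert_left, hu, hv]
  have hind := indepFun_of_dependsOn ((permLaw n).prod A.law) hf hg hdisj hdf hdg
  rw [← integral_indicator_one hm]
  exact hind.integral_mul_eq_mul_integral hf.aestronglyMeasurable hg.aestronglyMeasurable

open Classical in
theorem sum_integral_unheard_le (R : Finset (Fin n)) (v : Fin n) :
    ∑ u ∈ R.filter (fun u => v ∉ R.erase u), ∫ x : Setup A,
      (secondCount A f x.ports {u} x.coins v : ℝ) *
        (unheard A f (R.erase u) v).indicator 1 x ∂(setupLaw A) ≤ meanSecond A f R v := by
  have hi : ∀ u ∈ R.filter (fun u => v ∉ R.erase u), Integrable (fun x : Setup A =>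
      (secondCount A f x.ports {u} x.coins v : ℝ) *
        (unheard A f (R.erase u) v).indicator 1 x) (setupLaw A) := by
    intro u _
    refine ((integrable_secondCount_setup A f {u} v).indicator
      (measurableSet_unheard A f (R.erase u) v)).congr (Filter.Eventually.of_forall fun x => ?_)
    by_cases hx : x ∈ unheard A f (R.erase u) v <;> simp [hx]
  rw [← integral_finsetSum _ hi]
  refine integral_mono (integrable_finsetSum _ hi) (integrable_secondCount_setup A f R v)
    fun x => ?_
  refine le_trans (le_of_eq ?_)
    (Nat.cast_le.2 (sum_secondCount_singleton_le A f x.ports x.coins R v))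
  rw [Finset.sum_filter, Nat.cast_sum]
  refine Finset.sum_congr rfl fun u _ => ?_
  have hx : x ∈ unheard A f (R.erase u) v ↔
      ∀ w ∈ R.erase u, ¬ SendsTo A f x.ports x.coins w v := Iff.rfl
  by_cases h1 : v ∉ R.erase u
  · by_cases h2 : ∀ w ∈ R.erase u, ¬ SendsTo A f x.ports x.coins w v
    · rw [if_pos h1, if_pos ⟨h1, h2⟩, Set.indicator_of_mem (hx.2 h2), Pi.one_apply, mul_one]
    · rw [if_pos h1, if_neg fun h => h2 h.2, Set.indicator_of_notMem (mt hx.1 h2), mul_zero,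
        Nat.cast_zero]
  · rw [if_neg h1, if_neg fun h => h1 h.1, Nat.cast_zero]

/-- One factor `1 - R.card * q` is the chance of not hearing the other roots. The other loss `R.card
* q` pays for the round-1 messages of `u` and for the receivers in `R.erase u`, which are discarded.
-/
theorem le_sum_meanSecond {ε q : ℝ} (h : WakesUpAll A 2 ε) (f : Fin n ↪ ID)
    {R : Finset (Fin n)} (hn : 1 < n) (hq0 : 0 ≤ q)
    (hq : ∀ w ∈ R, meanFirst A (f w) ≤ q * ((n - 1 : ℕ) : ℝ)) (hq1 : R.card * q ≤ 1) :
    R.card * ((1 - R.card * q) * ((1 - ε - R.card * q) * ((n - 1 : ℕ) : ℝ))) ≤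
      ∑ v, meanSecond A f R v := by
  classical
  have hsingle : ∀ u ∈ R, (1 - ε - R.card * q) * ((n - 1 : ℕ) : ℝ) ≤
      ∑ v ∈ (R.erase u)ᶜ, meanSecond A f {u} v := by
    intro u hu
    have h1 := le_sum_meanSecond_singleton A h f u
    -- Each of the `R.card - 1` discarded receivers costs at most `q * (n - 1)`, and so does
    -- `meanFirst` of `u`.
    rw [← Finset.sum_add_sum_compl (R.erase u)] at h1
    have h2 : ∑ v ∈ R.erase u, meanSecond A f {u} v ≤
        (R.erase u).card • (q * ((n - 1 : ℕ) : ℝ)) :=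
      Finset.sum_le_card_nsmul _ _ _ fun v hv =>
        (meanSecond_singleton_le A f (Finset.ne_of_mem_erase hv)).trans (hq u hu)
    have h3 : ((R.erase u).card : ℝ) + 1 = R.card := by
      exact_mod_cast Finset.card_erase_add_one hu
    have h4 := hq u hu
    rw [nsmul_eq_mul] at h2
    rw [← h3]
    linarith
  have hv : ∀ v, ∑ u ∈ R.filter (fun u => v ∉ R.erase u),
      (1 - R.card * q) * meanSecond A f {u} v ≤ meanSecond A f R v := by
    intro v
    refine le_trans (Finset.sum_le_sum fun u hu => ?_) (sum_integral_unheard_le A f R v)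
    have hve := (Finset.mem_filter.1 hu).2
    rw [integral_secondCount_mul_unheard A f (Finset.notMem_erase u R) hve, mul_comm]
    refine mul_le_mul_of_nonneg_left ?_ (meanSecond_nonneg A f _ _)
    refine le_trans ?_ (le_measureReal_unheard A f hve
      (fun w hw => hq w (Finset.mem_of_mem_erase hw)) hn)
    refine sub_le_sub_left (mul_le_mul_of_nonneg_right ?_ hq0) 1
    exact_mod_cast Finset.card_le_card (Finset.erase_subset u R)
  refine le_trans ?_ (Finset.sum_le_sum fun v _ => hv v)
  have hswap : ∑ v, ∑ u ∈ R.filter (fun u => v ∉ R.erase u),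
      (1 - R.card * q) * meanSecond A f {u} v =
        ∑ u ∈ R, (1 - R.card * q) * ∑ v ∈ (R.erase u)ᶜ, meanSecond A f {u} v := by
    simp only [Finset.mul_sum]
    refine Finset.sum_comm' fun v u => ?_
    simp only [Finset.mem_univ, Finset.mem_filter, Finset.mem_compl, true_and]
    exact and_comm
  rw [hswap, ← nsmul_eq_mul]
  exact Finset.card_nsmul_le_sum _ _ _ fun u hu =>
    mul_le_mul_of_nonneg_left (hsingle u hu) (sub_nonneg.2 hq1)

theorem sum_meanFirst_le_expectedMessages (f : Fin n ↪ ID) (hn : 0 < n) :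
    ∃ S : Adversary n ID, ∑ u, meanFirst A (f u) ≤ expectedMessages A S 2 := by
  refine ⟨⟨f, permutedPorts fun _ => 1, Finset.univ, ⟨⟨0, hn⟩, Finset.mem_univ _⟩⟩, ?_⟩
  rw [expectedMessages_two]
  exact le_add_of_nonneg_right (Finset.sum_nonneg fun v _ =>
    integral_nonneg fun _ => Nat.cast_nonneg _)

end RandomRoots

/-! ### Choice of the roots and of the constants -/

/-- If the sum of `n` nonnegative numbers is less than `n * b / 2`, then more than `n / 2` of them
are at most `b`. -/
theorem half_lt_card_filter_le {n : ℕ} {a : Fin n → ℝ} {b : ℝ} (ha : ∀ u, 0 ≤ a u) (hb : 0 < b)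
    (h : ∑ u, a u < n * b / 2) :
    (n : ℝ) / 2 < (Finset.univ.filter fun u => a u ≤ b).card := by
  have h1 : ((Finset.univ.filter fun u => ¬ a u ≤ b).card : ℝ) * b ≤ ∑ u, a u := by
    rw [← nsmul_eq_mul]
    refine (Finset.card_nsmul_le_sum _ _ _ fun u hu => ?_).trans
      (Finset.sum_le_sum_of_subset_of_nonneg (Finset.filter_subset _ _) fun u _ _ => ha u)
    exact (not_le.1 (Finset.mem_filter.1 hu).2).le
  have h2 : ((Finset.univ.filter fun u => a u ≤ b).card : ℝ) +
      (Finset.univ.filter fun u => ¬ a u ≤ b).card = n := by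
    have := Finset.card_filter_add_card_filter_not (s := (Finset.univ : Finset (Fin n)))
      fun u => a u ≤ b
    rw [Finset.card_univ, Fintype.card_fin] at this
    exact_mod_cast this
  have h3 : ((Finset.univ.filter fun u => ¬ a u ≤ b).card : ℝ) < n / 2 := by
    refine lt_of_mul_lt_mul_right ?_ hb.le
    linarith
  linarith

end SyncClique

theorem mainTheorem4 (ε : ℝ) (hε0 : 0 < ε) (hε1 : ε < 1) :
    ∃ c : ℝ, 0 < c ∧ ∃ n₀ : ℕ, ∀ n : ℕ, n₀ ≤ n →
      ∀ (ID Msg : Type), Nonempty (Fin n ↪ ID) → Countable Msg →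
        ∀ A : SyncClique.Algorithm n ID Msg,
          SyncClique.WakesUpAll A 2 ε →
            ∃ S : SyncClique.Adversary n ID,
              c * (n : ℝ) ^ (3 / 2 : ℝ) ≤ SyncClique.expectedMessages A S 2 := by
  refine ⟨(1 - ε) / 16, by linarith, 16, ?_⟩
  rintro n hn ID Msg ⟨f⟩ hMsg A hA
  have hn16 : (16 : ℝ) ≤ n := by exact_mod_cast hn
  set s := √(n : ℝ) with hs
  have hss : s * s = n := Real.mul_self_sqrt (by linarith)
  have hs4 : 4 ≤ s := Real.le_sqrt_of_sq_le (by linarith)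
  have hpow : (n : ℝ) ^ (3 / 2 : ℝ) = n * s := by
    rw [hs, Real.sqrt_eq_rpow, ← Real.rpow_one_add' (by linarith) (by norm_num)]
    norm_num
  rw [hpow]
  set d := 1 - ε with hd
  have hd0 : 0 < d := by linarith
  by_cases hcase : d / 16 * (n * s) ≤ ∑ u, SyncClique.meanFirst A (f u)
  · obtain ⟨S, hS⟩ := SyncClique.sum_meanFirst_le_expectedMessages A f (by omega)
    exact ⟨S, hcase.trans hS⟩
  -- The threshold `b` is chosen so that `n * b / 2` is exactly the bound that fails in `hcase`.
  have hgood := SyncClique.half_lt_card_filter_le (b := d / 8 * s)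
    (fun u => SyncClique.meanFirst_nonneg A (f u)) (by positivity) (by linarith)
  have hk1 : s ≤ ⌈s⌉₊ := Nat.le_ceil s
  have hk2 : (⌈s⌉₊ : ℝ) < s + 1 := Nat.ceil_lt_add_one (by linarith)
  -- With `s ≥ 4`, which is where `n₀ = 16` comes from, `⌈s⌉₊ < s + 1 ≤ 2 * s ≤ n / 2`, so there are
  -- enough cheap nodes to form `R`.
  have hns : 2 * s ≤ n / 2 := by nlinarith
  obtain ⟨R, hRsub, hRcard⟩ := Finset.exists_subset_card_eq (n := ⌈s⌉₊)
    (s := Finset.univ.filter fun u => SyncClique.meanFirst A (f u) ≤ d / 8 * s) (by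
      rw [← Nat.cast_le (α := ℝ)]
      linarith)
  have hRne : R.Nonempty := by
    rw [← Finset.card_pos, hRcard, Nat.ceil_pos]
    linarith
  obtain ⟨S, hS⟩ := SyncClique.exists_sum_meanSecond_le_expectedMessages A f hRne
  refine ⟨S, le_trans ?_ hS⟩
  have hn1 : ((n - 1 : ℕ) : ℝ) = n - 1 := by
    rw [Nat.cast_sub (by omega), Nat.cast_one]
  have hn1pos : (0 : ℝ) < n - 1 := by linarith
  -- This bounds the probability that a root in `R` reaches a given node.
  set q := d / 8 * s / (n - 1) with hq
  have hq0 : 0 ≤ q := by positivity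
  -- The left side is at most `2 * s * q = d / 4 * n / (n - 1)`. The bound `d / 2` leaves both
  -- factors of `le_sum_meanSecond` large: `1 - R.card * q ≥ 1 / 2` and `d - R.card * q ≥ d / 2`.
  have hkq : (R.card : ℝ) * q ≤ d / 2 := by
    rw [hRcard, hq, ← mul_div_assoc, div_le_iff₀ hn1pos]
    have h1 : (⌈s⌉₊ : ℝ) * s ≤ 2 * s * s := mul_le_mul_of_nonneg_right (by linarith) (by linarith)
    nlinarith
  refine le_trans ?_ (SyncClique.le_sum_meanSecond A hA f (by omega) hq0 (fun w hw => ?_)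
    (by linarith))
  · rw [hn1]
    have h1 : d * n / 4 ≤ (d - R.card * q) * ((n : ℝ) - 1) := by nlinarith
    have h2 : 1 / 2 * (d * n / 4) ≤
        (1 - R.card * q) * ((d - R.card * q) * ((n : ℝ) - 1)) :=
      mul_le_mul (by linarith) h1 (by positivity) (by linarith)
    have h3 : s * (1 / 2 * (d * n / 4)) ≤
        R.card * ((1 - R.card * q) * ((d - R.card * q) * ((n : ℝ) - 1))) :=
      mul_le_mul (by rw [hRcard]; exact hk1) h2 (by positivity) (by positivity)
    have h4 : 0 ≤ d * n * s := by positivity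
    linarith
  · rw [hn1, hq, div_mul_cancel₀ _ hn1pos.ne']
    exact (Finset.mem_filter.1 (hRsub hw)).2
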